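/- Let $\mathcal P(\mathbb R)$ be the set of Borel probability measures on $\mathbb R$ with the topology of weak convergence, and let $\mathcal P([0,1])$ be the set of those $\mu\in\mathcal P(\mathbb R)$ with $\mu([0,1])=1$. For probability measures $\mu,\nu$ on $\mathbb R$ let $$W_2^2(\mu,\nu)=\inf_{\pi}\int |x-y|^2\,d\pi(x,y)\in[0,\infty],$$ the infimum being over all couplings $\pi$ of $\mu$ and $\nu$. Let $\mu_0=U([0,1])$ be the uniform measure on $[0,1]$. For $\nu\in\mathcal P(\mathbb R)$ with finite second moment let $T_{\mu_0}^{\nu}$ be the ($\mu_0$-a.e. unique) optimal transport map from $\mu_0$ to $\nu$, that is, the minimizer of $\int|T(x)-x|^2\,d\mu_0(x)$ among measurable maps $T$ with $T\#\mu_0=\nu$. If $\nu$ has infinite second moment, set $\|T_{\mu_0}^{\nu}-T_{\mu_0}^{\eta}\|_{L^2(\mu_0)}=\infty$. Define $$W_2\mathrm{BCM}=\bigcup_{\lambda\in\mathcal P([0,1])}\ \operatorname*{argmin}_{\nu\in\mathcal P(\mathbb R)}\int_{[0,1]} W_2^2(\nu,a\delta_0+(1-a)\delta_1)\,d\lambda(a),$$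 $$\mathrm{LBCM}=\bigcup_{\lambda\in\mathcal P([0,1])}\ \operatorname*{argmin}_{\nu\in\mathcal P(\mathbb R)}\int_{[0,1]} \big\|T_{\mu_0}^{\nu}-T_{\mu_0}^{a\delta_0+(1-a)\delta_1}\big\|_{L^2(\mu_0)}^2\,d\lambda(a).$$ **Theorem.** The sets $W_2\mathrm{BCM}$ and $\mathrm{LBCM}$ are both contained in $\mathcal P([0,1])$ and are both dense in $\mathcal P([0,1])$ with respect to weak convergence. In fact every $\mu\in\mathcal P([0,1])$ belongs to $\mathrm{LBCM}$. By contrast, the convex hull $$\operatorname{conv}\big(\{U([0,1])\}\cup\{a\delta_0+(1-a)\delta_1 : a\in[0,1]\}\big)\subseteq\mathcal P([0,1])$$ is not dense in $\mathcal P([0,1])$ with respect to weak convergence. -/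

import Mathlib

open MeasureTheory
open scoped ENNReal NNReal

namespace BarycentricCoding

/-- `𝒫(Ω)`: the Borel probability measures on `E` that give full mass to `Ω`. -/
def probOn {E : Type*} [MeasurableSpace E] (Ω : Set E) : Set (ProbabilityMeasure E) :=
  {μ | (μ : Measure E) Ω = 1}

/-- `T` is an optimal transport map from `μ` to `ν` for the squared-distance cost: it pushes `μ`
to `ν`, has finite cost, and has the least cost among all measurable maps pushing `μ` to `ν`. -/
structure IsOptimalMap {E : Type*} [NormedAddCommGroup E] [MeasurableSpace E]
    (μ ν : Measure E) (T : E → E) : Prop where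
  measurable : Measurable T
  map_eq : μ.map T = ν
  cost_ne_top : ∫⁻ x, ‖T x - x‖ₑ ^ 2 ∂μ ≠ ∞
  cost_le : ∀ S : E → E, Measurable S → μ.map S = ν →
    ∫⁻ x, ‖T x - x‖ₑ ^ 2 ∂μ ≤ ∫⁻ x, ‖S x - x‖ₑ ^ 2 ∂μ

/-- The squared linear optimal transport distance `‖T_{μ₀}^ν - T_{μ₀}^η‖²_{L²(μ₀)}`.
The infimum runs over the optimal maps from `μ₀` to `ν` and to `η`. For an absolutely continuous
base measure with finite second moment these are unique up to `μ₀`-null sets, so it is the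
infimum of a single value; it is `∞` when `ν` or `η` has no optimal map of finite cost. -/
noncomputable def lotSq {E : Type*} [NormedAddCommGroup E] [MeasurableSpace E]
    (μ₀ ν η : Measure E) : ℝ≥0∞ :=
  ⨅ (T : E → E) (_ : IsOptimalMap μ₀ ν T) (S : E → E) (_ : IsOptimalMap μ₀ η S),
    ∫⁻ x, ‖T x - S x‖ₑ ^ 2 ∂μ₀

/-- The couplings (transport plans) of `μ` and `ν`. -/
def couplings {E : Type*} [MeasurableSpace E] (μ ν : Measure E) : Set (Measure (E × E)) :=
  {π | π.map Prod.fst = μ ∧ π.map Prod.snd = ν}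

/-- The squared 2-Wasserstein distance, through couplings. -/
noncomputable def wassersteinSq {E : Type*} [NormedAddCommGroup E] [MeasurableSpace E]
    (μ ν : Measure E) : ℝ≥0∞ :=
  ⨅ π ∈ couplings μ ν, ∫⁻ p, ‖p.1 - p.2‖ₑ ^ 2 ∂π

/-- The probability measures at which `F` attains a finite minimum over all of `𝒫(E)`. -/
def argmin {E : Type*} [MeasurableSpace E] (F : ProbabilityMeasure E → ℝ≥0∞) :
    Set (ProbabilityMeasure E) :=
  {ν | F ν ≠ ∞ ∧ ∀ ν', F ν ≤ F ν'}

/-- The `W₂` barycentric coding model of a family `(μ i)`: all minimizers of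
`ν ↦ ∫ W₂²(ν, μ i) dl(i)`, for `l` a probability measure on the index space. -/
noncomputable def w2BCM {E I : Type*} [NormedAddCommGroup E] [MeasurableSpace E]
    [MeasurableSpace I] (μ : I → ProbabilityMeasure E) : Set (ProbabilityMeasure E) :=
  {η | ∃ l : ProbabilityMeasure I,
    η ∈ argmin fun ν => ∫⁻ i, wassersteinSq (ν : Measure E) (μ i : Measure E) ∂(l : Measure I)}

/-- The linear barycentric coding model with base measure `μ₀` of a family `(μ i)`: all
minimizers of `ν ↦ ∫ ‖T_{μ₀}^ν - T_{μ₀}^{μ i}‖²_{L²(μ₀)} dl(i)`, for `l` a probability measure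
on the index space. -/
noncomputable def lbcm {E I : Type*} [NormedAddCommGroup E] [MeasurableSpace E]
    [MeasurableSpace I] (μ₀ : ProbabilityMeasure E) (μ : I → ProbabilityMeasure E) :
    Set (ProbabilityMeasure E) :=
  {η | ∃ l : ProbabilityMeasure I,
    η ∈ argmin fun ν =>
      ∫⁻ i, lotSq (μ₀ : Measure E) (ν : Measure E) (μ i : Measure E) ∂(l : Measure I)}

/-- The convex hull of a set of probability measures: the probability measures that are finite
convex combinations of its elements. Over `ℝ≥0` the word convex has its usual meaning (closed under
`s • x + t • y` with `s, t ≥ 0` and `s + t = 1`). -/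
def convHull {E : Type*} [MeasurableSpace E] (S : Set (ProbabilityMeasure E)) :
    Set (ProbabilityMeasure E) :=
  {μ | (μ : Measure E) ∈ convexHull ℝ≥0 ((fun ν : ProbabilityMeasure E => (ν : Measure E)) '' S)}

/-- The uniform measure on `[0,1]`, as a probability measure on `ℝ`. -/
noncomputable def uniformUnit : ProbabilityMeasure ℝ :=
  ⟨volume.restrict (Set.Icc 0 1), ⟨by simp⟩⟩

/-- The two-point measure `a δ₀ + (1 - a) δ₁`, for `a ∈ [0,1]`. -/
noncomputable def twoPoint (a : Set.Icc (0 : ℝ) 1) : ProbabilityMeasure ℝ :=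
  ⟨ENNReal.ofReal (a : ℝ) • Measure.dirac 0 + ENNReal.ofReal (1 - (a : ℝ)) • Measure.dirac 1,
    ⟨by
      have h0 : (0 : ℝ) ≤ a := a.2.1
      have h1 : (0 : ℝ) ≤ 1 - a := sub_nonneg.2 a.2.2
      simp [← ENNReal.ofReal_add h0 h1]⟩⟩

end BarycentricCoding

open BarycentricCoding

namespace BarycentricCoding

open Set ProbabilityTheory

/-! On the line, quadratic transport is governed by quantile functions. Let Q be the quantile
function of ν. Weak duality shows that the monotone coupling of ν with a two-point measure is
optimal, so both W₂² and the squared linear distance equal ∫|Q - `step a`|². For fixed x, `step a x`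
is under l a Bernoulli variable of mean L(x) = l{a < x}. Averaging over l therefore turns both
functionals into ∫|Q - L|² + ∫(L - L²). The second term is finite and independent of ν, so the law
of L under the uniform measure is the unique minimizer (`mem_argmin_iff_eq_barycenter`).

Every quantile function of a measure on [0,1] occurs as such an L (`exists_leftMass_eq_quantile`),
so both models are all of 𝒫([0,1]), not merely dense. The convex hull misses δ_{1/2}: a continuous
function vanishing at 1/2 has integral bounded away from 0 on all generators, a bound that survives
convex combinations and weak limits. -/

theorem enorm_sq_eq_ofReal (r : ℝ) : ‖r‖ₑ ^ 2 = ENNReal.ofReal (r ^ 2) := by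
  rw [← ofReal_norm, ← ENNReal.ofReal_pow (norm_nonneg r), Real.norm_eq_abs, sq_abs]

theorem coe_uniformUnit :
    (uniformUnit : Measure ℝ) = volume.restrict (Icc (0 : ℝ) 1) := rfl

theorem coe_twoPoint (a : Icc (0 : ℝ) 1) :
    (twoPoint a : Measure ℝ) = ENNReal.ofReal (a : ℝ) • Measure.dirac 0 +
      ENNReal.ofReal (1 - (a : ℝ)) • Measure.dirac 1 := rfl

theorem ae_uniformUnit_mem_Ioo : ∀ᵐ x ∂(uniformUnit : Measure ℝ), x ∈ Ioo (0 : ℝ) 1 := by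
  rw [coe_uniformUnit, ← restrict_Ioo_eq_restrict_Icc]
  exact ae_restrict_mem measurableSet_Ioo

/-- The optimal map from the uniform measure to `a δ₀ + (1 - a) δ₁`. -/
noncomputable def step (a x : ℝ) : ℝ := if a < x then 1 else 0

theorem measurable_step (a : ℝ) : Measurable (step a) :=
  Measurable.ite measurableSet_Ioi measurable_const measurable_const

theorem monotone_step (a : ℝ) : Monotone (step a) := by
  intro x y h
  unfold step
  split_ifs with h1 h2
  exacts [le_rfl, absurd (h1.trans_le h) h2, zero_le_one, le_rfl]

theorem map_step (a : Icc (0 : ℝ) 1) :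
    (uniformUnit : Measure ℝ).map (step a) = (twoPoint a : Measure ℝ) := by
  obtain ⟨a, h0, h1⟩ := a
  have hU : (uniformUnit : Measure ℝ) =
      volume.restrict (Icc 0 a) + volume.restrict (Ioc a 1) := by
    rw [coe_uniformUnit, ← Icc_union_Ioc_eq_Icc h0 h1, Measure.restrict_union _ measurableSet_Ioc]
    exact Set.disjoint_left.2 fun x hx hx' => absurd hx.2 (not_le.2 hx'.1)
  have e0 : (volume.restrict (Icc 0 a)).map (step a) =
      (volume.restrict (Icc 0 a)).map fun _ => (0 : ℝ) := by
    refine Measure.map_congr ?_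
    filter_upwards [ae_restrict_mem measurableSet_Icc] with x hx
    simp [step, not_lt.2 hx.2]
  have e1 : (volume.restrict (Ioc a 1)).map (step a) =
      (volume.restrict (Ioc a 1)).map fun _ => (1 : ℝ) := by
    refine Measure.map_congr ?_
    filter_upwards [ae_restrict_mem measurableSet_Ioc] with x hx
    simp [step, hx.1]
  rw [hU, Measure.map_add _ _ (measurable_step a), e0, e1, Measure.map_const, Measure.map_const,
    coe_twoPoint]
  simp

/-! ### Duality and the Wasserstein distance to two-point measures -/

/-- Weak duality: a pair of potentials that is tight on `(X, Y)` bounds the cost of every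
coupling of the laws of `X` and `Y` from below. The constant `K` makes the potentials
nonnegative. -/
theorem lintegral_le_of_potentials {α : Type*} [MeasurableSpace α] {P : Measure α}
    [IsProbabilityMeasure P] {π : Measure (ℝ × ℝ)} {X Y : α → ℝ} (hX : Measurable X)
    (hY : Measurable Y) (h1 : π.map Prod.fst = P.map X) (h2 : π.map Prod.snd = P.map Y)
    {A B : ℝ → ℝ≥0∞} (hA : Measurable A) (hB : Measurable B) {K : ℝ≥0∞} (hK : K ≠ ∞)
    (hle : ∀ᵐ p ∂π, A p.1 + B p.2 ≤ ‖p.1 - p.2‖ₑ ^ 2 + K)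
    (heq : ∀ᵐ x ∂P, ‖X x - Y x‖ₑ ^ 2 + K ≤ A (X x) + B (Y x)) :
    ∫⁻ x, ‖X x - Y x‖ₑ ^ 2 ∂P ≤ ∫⁻ p, ‖p.1 - p.2‖ₑ ^ 2 ∂π := by
  have hπ : π univ = 1 := by
    have : π.map Prod.fst univ = 1 := by
      rw [h1, Measure.map_apply hX .univ]; simp
    rwa [Measure.map_apply measurable_fst .univ, preimage_univ] at this
  have hP : ∫⁻ x, ‖X x - Y x‖ₑ ^ 2 ∂P + K ≤ ∫⁻ p, ‖p.1 - p.2‖ₑ ^ 2 ∂π + K := by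
    calc ∫⁻ x, ‖X x - Y x‖ₑ ^ 2 ∂P + K
        = ∫⁻ x, (‖X x - Y x‖ₑ ^ 2 + K) ∂P := by
          rw [lintegral_add_right _ measurable_const]; simp
      _ ≤ ∫⁻ x, (A (X x) + B (Y x)) ∂P := lintegral_mono_ae heq
      _ = ∫⁻ y, A y ∂(P.map X) + ∫⁻ y, B y ∂(P.map Y) := by
          rw [lintegral_map hA hX, lintegral_map hB hY, lintegral_add_left (f := fun x => A (X x)) (hA.comp hX)]
      _ = ∫⁻ p, (A p.1 + B p.2) ∂π := by
          rw [← h1, ← h2, lintegral_map hA measurable_fst, lintegral_map hB measurable_snd,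
            lintegral_add_left (f := fun p : ℝ × ℝ => A p.1) (hA.comp measurable_fst)]
      _ ≤ ∫⁻ p, (‖p.1 - p.2‖ₑ ^ 2 + K) ∂π := lintegral_mono_ae hle
      _ = ∫⁻ p, ‖p.1 - p.2‖ₑ ^ 2 ∂π + K := by
          rw [lintegral_add_right _ measurable_const]; simp [hπ]
  exact (ENNReal.add_le_add_iff_right hK).1 hP

theorem lintegral_step_le_of_mem_couplings {Q : ℝ → ℝ} (hQ : Measurable Q)
    (hmono : MonotoneOn Q (Ioo 0 1)) (a : Icc (0 : ℝ) 1) {π : Measure (ℝ × ℝ)}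
    (hπ : π ∈ couplings ((uniformUnit : Measure ℝ).map Q) (twoPoint a : Measure ℝ)) :
    ∫⁻ x, ‖Q x - step a x‖ₑ ^ 2 ∂(uniformUnit : Measure ℝ) ≤
      ∫⁻ p, ‖p.1 - p.2‖ₑ ^ 2 ∂π := by
  obtain ⟨h1, h2⟩ := hπ
  have hae {s : Set ℝ} (hs : MeasurableSet s) (h : (twoPoint a : Measure ℝ) sᶜ = 0) :
      ∀ᵐ p ∂π, p.2 ∈ s := by
    rw [← h2, Measure.map_apply measurable_snd hs.compl] at h
    exact h
  rw [← map_step] at h2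
  -- For a = 0 or a = 1, monotonicity on the open interval says nothing about Q(a). The target is
  -- then a Dirac mass, and the cost itself serves as potential.
  rcases eq_or_lt_of_le a.2.1 with ha0 | ha0
  · refine lintegral_le_of_potentials hQ (measurable_step a) h1 h2
      (A := fun x => ‖x - 1‖ₑ ^ 2) (B := 0) (by fun_prop) measurable_const
      (K := 0) (by simp) ?_ ?_
    · filter_upwards [hae (measurableSet_singleton 1) (by simp [coe_twoPoint, ← ha0])] with p hp
      simp [mem_singleton_iff.1 hp]
    · filter_upwards [ae_uniformUnit_mem_Ioo] with x hx
      simp [step, ← ha0, hx.1]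
  rcases eq_or_lt_of_le a.2.2 with ha1 | ha1
  · refine lintegral_le_of_potentials hQ (measurable_step a) h1 h2
      (A := fun x => ‖x‖ₑ ^ 2) (B := 0) (by fun_prop) measurable_const
      (K := 0) (by simp) ?_ ?_
    · filter_upwards [hae (measurableSet_singleton 0) (by simp [coe_twoPoint, ha1])] with p hp
      simp [mem_singleton_iff.1 hp]
    · filter_upwards [ae_uniformUnit_mem_Ioo] with x hx
      simp [step, ha1, not_lt.2 hx.2.le]
  -- The two branches of the minimum below correspond to the targets 0 and 1. The shift 2q makes
  -- them cross at q, the value of Q where `step a` jumps. Adding M keeps both potentials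
  -- nonnegative, and K = 2M compensates.
  set q : ℝ := Q a with hq
  set M : ℝ := 1 + 2 * |q| with hM
  have hq1 := neg_abs_le q
  have hq2 := le_abs_self q
  have hMA (x : ℝ) : 0 ≤ min (x ^ 2) (x ^ 2 - 2 * x + 2 * q) + M := by
    rcases min_choice (x ^ 2) (x ^ 2 - 2 * x + 2 * q) with h | h <;> rw [h] <;>
      nlinarith [sq_nonneg x, sq_nonneg (x - 1)]
  refine lintegral_le_of_potentials hQ (measurable_step a) h1 h2
    (A := fun x => ENNReal.ofReal (min (x ^ 2) (x ^ 2 - 2 * x + 2 * q) + M))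
    (B := fun y => ENNReal.ofReal (if y = 1 then 1 - 2 * q + M else M))
    (by fun_prop)
    ((Measurable.ite (measurableSet_singleton 1) measurable_const measurable_const).ennreal_ofReal)
    (K := ENNReal.ofReal (2 * M)) ENNReal.ofReal_ne_top ?_ ?_
  · filter_upwards [hae (s := {0, 1}) (by measurability) (by simp [coe_twoPoint])] with p hp
    have hM0 : 0 ≤ M := by positivity
    rw [enorm_sq_eq_ofReal, ← ENNReal.ofReal_add (hMA _) (by split_ifs <;> linarith),
      ← ENNReal.ofReal_add (sq_nonneg _) (by linarith)]
    refine ENNReal.ofReal_le_ofReal ?_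
    have m1 := min_le_left (p.1 ^ 2) (p.1 ^ 2 - 2 * p.1 + 2 * q)
    have m2 := min_le_right (p.1 ^ 2) (p.1 ^ 2 - 2 * p.1 + 2 * q)
    rcases hp with hp | hp
    · rw [hp, if_neg zero_ne_one]; linarith
    · rw [mem_singleton_iff.1 hp, if_pos rfl]; linarith
  · filter_upwards [ae_uniformUnit_mem_Ioo] with x hx
    have hM0 : 0 ≤ M := by positivity
    rw [enorm_sq_eq_ofReal, ← ENNReal.ofReal_add (hMA _) (by split_ifs <;> linarith),
      ← ENNReal.ofReal_add (sq_nonneg _) (by linarith)]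
    refine ENNReal.ofReal_le_ofReal ?_
    unfold step
    split_ifs with h h' h'
    · have : q ≤ Q x := hmono ⟨ha0, ha1⟩ hx h.le
      rw [min_eq_right (by linarith)]; linarith
    · simp at h'
    · simp at h'
    · have : Q x ≤ q := hmono hx ⟨ha0, ha1⟩ (not_lt.1 h)
      rw [min_eq_left (by linarith)]; linarith

theorem wassersteinSq_le_of_map {P : Measure ℝ} {T S : ℝ → ℝ} (hT : Measurable T)
    (hS : Measurable S) :
    wassersteinSq (P.map T) (P.map S) ≤ ∫⁻ x, ‖T x - S x‖ₑ ^ 2 ∂P := by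
  have hTS : Measurable fun x => (T x, S x) := hT.prodMk hS
  refine iInf₂_le_of_le (P.map fun x => (T x, S x)) ⟨?_, ?_⟩ ?_
  · rw [Measure.map_map measurable_fst hTS]; rfl
  · rw [Measure.map_map measurable_snd hTS]; rfl
  · rw [lintegral_map (by fun_prop) hTS]

theorem wassersteinSq_map_twoPoint {Q : ℝ → ℝ} (hQ : Measurable Q)
    (hmono : MonotoneOn Q (Ioo 0 1)) (a : Icc (0 : ℝ) 1) :
    wassersteinSq ((uniformUnit : Measure ℝ).map Q) (twoPoint a : Measure ℝ) =
      ∫⁻ x, ‖Q x - step a x‖ₑ ^ 2 ∂(uniformUnit : Measure ℝ) := by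
  refine le_antisymm ?_ (le_iInf₂ fun π hπ => lintegral_step_le_of_mem_couplings hQ hmono a hπ)
  rw [← map_step]
  exact wassersteinSq_le_of_map hQ (measurable_step a)

/-! ### Averaging over the weights -/

/-- The mass that `l` gives to the weights smaller than `x`. -/
noncomputable def leftMass (l : ProbabilityMeasure (Icc (0 : ℝ) 1)) (x : ℝ) : ℝ :=
  (l : Measure (Icc (0 : ℝ) 1)).real {a | (a : ℝ) < x}

theorem monotone_leftMass (l : ProbabilityMeasure (Icc (0 : ℝ) 1)) : Monotone (leftMass l) :=
  fun _ _ h => measureReal_mono fun _ ha => lt_of_lt_of_le ha h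

theorem leftMass_mem (l : ProbabilityMeasure (Icc (0 : ℝ) 1)) (x : ℝ) :
    leftMass l x ∈ Icc (0 : ℝ) 1 :=
  ⟨measureReal_nonneg, measureReal_le_one⟩

/-- Bias-variance decomposition for a Bernoulli variable of mean `leftMass l x`. -/
theorem lintegral_step_weight (l : ProbabilityMeasure (Icc (0 : ℝ) 1)) (q x : ℝ) :
    ∫⁻ a : Icc (0 : ℝ) 1, ‖q - step a x‖ₑ ^ 2 ∂(l : Measure (Icc (0 : ℝ) 1)) =
      ‖q - leftMass l x‖ₑ ^ 2 + ENNReal.ofReal (leftMass l x - leftMass l x ^ 2) := by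
  have hs : MeasurableSet {a : Icc (0 : ℝ) 1 | (a : ℝ) < x} :=
    measurableSet_lt measurable_subtype_coe measurable_const
  obtain ⟨hL0, hL1⟩ := leftMass_mem l x
  have e1 : (l : Measure (Icc (0 : ℝ) 1)) {a | (a : ℝ) < x} = ENNReal.ofReal (leftMass l x) := by
    rw [leftMass, ofReal_measureReal]
  have e2 : (l : Measure (Icc (0 : ℝ) 1)) {a | (a : ℝ) < x}ᶜ =
      ENNReal.ofReal (1 - leftMass l x) := by
    rw [leftMass, ← probReal_compl_eq_one_sub hs, ofReal_measureReal]
  rw [← lintegral_add_compl _ hs,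
    setLIntegral_congr_fun (g := fun _ => ‖q - 1‖ₑ ^ 2) hs
      (fun a ha => by simp only [step, if_pos (show (a : ℝ) < x from ha)]),
    setLIntegral_congr_fun (g := fun _ => ‖q - 0‖ₑ ^ 2) hs.compl
      (fun a ha => by simp only [step, if_neg (show ¬ (a : ℝ) < x from ha)]),
    setLIntegral_const, setLIntegral_const, e1, e2]
  simp only [enorm_sq_eq_ofReal]
  rw [← ENNReal.ofReal_mul (sq_nonneg _), ← ENNReal.ofReal_mul (sq_nonneg _),
    ← ENNReal.ofReal_add (by positivity) (mul_nonneg (sq_nonneg _) (by linarith)),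
    ← ENNReal.ofReal_add (sq_nonneg _) (by nlinarith)]
  congr 1
  ring

theorem lintegral_lintegral_step (l : ProbabilityMeasure (Icc (0 : ℝ) 1)) {T : ℝ → ℝ}
    (hT : Measurable T) :
    ∫⁻ a : Icc (0 : ℝ) 1, ∫⁻ x, ‖T x - step a x‖ₑ ^ 2 ∂(uniformUnit : Measure ℝ)
        ∂(l : Measure (Icc (0 : ℝ) 1)) =
      ∫⁻ x, ‖T x - leftMass l x‖ₑ ^ 2 ∂(uniformUnit : Measure ℝ) +
        ∫⁻ x, ENNReal.ofReal (leftMass l x - leftMass l x ^ 2) ∂(uniformUnit : Measure ℝ) := by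
  have hstep : Measurable fun p : Icc (0 : ℝ) 1 × ℝ => step p.1 p.2 :=
    Measurable.ite (measurableSet_lt (by fun_prop) measurable_snd) measurable_const
      measurable_const
  have hL := (monotone_leftMass l).measurable
  rw [lintegral_lintegral_swap]
  · simp only [lintegral_step_weight]
    rw [lintegral_add_right _ (by fun_prop)]
  · exact (((hT.comp measurable_snd).sub hstep).enorm.pow_const 2).aemeasurable

theorem lintegral_leftMass_sub_sq_ne_top (l : ProbabilityMeasure (Icc (0 : ℝ) 1)) :
    ∫⁻ x, ENNReal.ofReal (leftMass l x - leftMass l x ^ 2) ∂(uniformUnit : Measure ℝ) ≠ ∞ := by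
  refine ne_top_of_le_ne_top ENNReal.one_ne_top ?_
  calc _ ≤ ∫⁻ _, 1 ∂(uniformUnit : Measure ℝ) := lintegral_mono fun x => by
        rw [ENNReal.ofReal_le_one]
        nlinarith [(leftMass_mem l x).2, sq_nonneg (leftMass l x)]
    _ = 1 := by simp

/-! ### Optimality of monotone maps and the linear distance -/

theorem exists_leftMass_eq_id :
    ∃ l : ProbabilityMeasure (Icc (0 : ℝ) 1), ∀ x ∈ Ioo (0 : ℝ) 1, leftMass l x = x := by
  let f : ℝ → Icc (0 : ℝ) 1 := projIcc 0 1 zero_le_one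
  have hf : Measurable f := continuous_projIcc.measurable
  refine ⟨uniformUnit.map hf.aemeasurable, fun x hx => ?_⟩
  have hs : MeasurableSet {a : Icc (0 : ℝ) 1 | (a : ℝ) < x} :=
    measurableSet_lt measurable_subtype_coe measurable_const
  rw [leftMass, ProbabilityMeasure.toMeasure_map, map_measureReal_apply hf hs, coe_uniformUnit,
    measureReal_restrict_apply (hf hs)]
  have : f ⁻¹' {a | (a : ℝ) < x} ∩ Icc 0 1 = Ico 0 x := by
    ext t
    simp only [mem_inter_iff, mem_preimage, mem_ofPred_eq, mem_Icc, mem_Ico]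
    constructor
    · rintro ⟨h, h0, h1⟩
      rw [show f t = ⟨t, h0, h1⟩ from projIcc_of_mem _ ⟨h0, h1⟩] at h
      exact ⟨h0, h⟩
    · rintro ⟨h0, h⟩
      have h1 : t ≤ 1 := h.le.trans hx.2.le
      rw [show f t = ⟨t, h0, h1⟩ from projIcc_of_mem _ ⟨h0, h1⟩]
      exact ⟨h, h0, h1⟩
  rw [this]
  simp [measureReal_def, hx.1.le]

/-- For uniform l, L is the identity on (0,1), so the cost ∫|T - x|² is, up to a finite constant,
the average over a of ∫|T - `step a`|². Each of these dominates W₂² to a two-point measure, with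
equality for the monotone map. -/
theorem isOptimalMap_of_monotoneOn {Q : ℝ → ℝ} (hQ : Measurable Q)
    (hmono : MonotoneOn Q (Ioo 0 1))
    (hfin : ∫⁻ x, ‖Q x - x‖ₑ ^ 2 ∂(uniformUnit : Measure ℝ) ≠ ∞) :
    IsOptimalMap (uniformUnit : Measure ℝ) ((uniformUnit : Measure ℝ).map Q) Q := by
  refine ⟨hQ, rfl, hfin, fun S hS hSQ => ?_⟩
  obtain ⟨l, hl⟩ := exists_leftMass_eq_id
  have hcost (T : ℝ → ℝ) : ∫⁻ x, ‖T x - leftMass l x‖ₑ ^ 2 ∂(uniformUnit : Measure ℝ) =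
      ∫⁻ x, ‖T x - x‖ₑ ^ 2 ∂(uniformUnit : Measure ℝ) := by
    refine lintegral_congr_ae ?_
    filter_upwards [ae_uniformUnit_mem_Ioo] with x hx
    rw [hl x hx]
  rw [← hcost Q, ← hcost S, ← ENNReal.add_le_add_iff_right (lintegral_leftMass_sub_sq_ne_top l),
    ← lintegral_lintegral_step l hQ, ← lintegral_lintegral_step l hS]
  refine lintegral_mono fun a => ?_
  rw [← wassersteinSq_map_twoPoint hQ hmono a, ← hSQ, ← map_step]
  exact wassersteinSq_le_of_map hS (measurable_step a)

theorem wassersteinSq_le_lotSq (μ ν η : Measure ℝ) : wassersteinSq ν η ≤ lotSq μ ν η := by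
  refine le_iInf₂ fun T hT => le_iInf₂ fun S hS => ?_
  rw [← hT.map_eq, ← hS.map_eq]
  exact wassersteinSq_le_of_map hT.measurable hS.measurable

theorem lotSq_map_twoPoint {Q : ℝ → ℝ} (hQ : Measurable Q)
    (hmono : MonotoneOn Q (Ioo 0 1)) (a : Icc (0 : ℝ) 1) :
    lotSq (uniformUnit : Measure ℝ) ((uniformUnit : Measure ℝ).map Q) (twoPoint a : Measure ℝ) =
      ∫⁻ x, ‖Q x - step a x‖ₑ ^ 2 ∂(uniformUnit : Measure ℝ) := by
  refine le_antisymm ?_ (wassersteinSq_map_twoPoint hQ hmono a ▸ wassersteinSq_le_lotSq _ _ _)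
  have hone : ∀ᵐ x ∂(uniformUnit : Measure ℝ), ‖step a x - x‖ₑ ^ 2 ≤ 1 := by
    filter_upwards [ae_uniformUnit_mem_Ioo] with x hx
    rw [enorm_sq_eq_ofReal, ENNReal.ofReal_le_one]
    unfold step
    split_ifs <;> nlinarith [hx.1, hx.2]
  have hstep : ∫⁻ x, ‖step a x - x‖ₑ ^ 2 ∂(uniformUnit : Measure ℝ) ≠ ∞ :=
    ne_top_of_le_ne_top ENNReal.one_ne_top ((lintegral_mono_ae hone).trans (by simp))
  -- Optimal maps must have finite cost. If the right side is finite, comparison with the bounded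
  -- `step a` gives this for Q.
  by_cases hfin : ∫⁻ x, ‖Q x - step a x‖ₑ ^ 2 ∂(uniformUnit : Measure ℝ) = ∞
  · rw [hfin]; exact le_top
  have hQfin : ∫⁻ x, ‖Q x - x‖ₑ ^ 2 ∂(uniformUnit : Measure ℝ) ≠ ∞ := by
    have hle (x : ℝ) : ‖Q x - x‖ₑ ^ 2 ≤ 2 * ‖Q x - step a x‖ₑ ^ 2 + 2 * ‖step a x - x‖ₑ ^ 2 := by
      simp only [enorm_sq_eq_ofReal]
      rw [← ENNReal.ofReal_ofNat 2, ← ENNReal.ofReal_mul zero_le_two,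
        ← ENNReal.ofReal_mul zero_le_two, ← ENNReal.ofReal_add (by positivity) (by positivity)]
      refine ENNReal.ofReal_le_ofReal ?_
      nlinarith [sq_nonneg (Q x - step a x - (step a x - x))]
    refine ne_top_of_le_ne_top ?_ (lintegral_mono hle)
    have := measurable_step a
    rw [lintegral_add_left (by fun_prop), lintegral_const_mul _ (by fun_prop),
      lintegral_const_mul _ (by fun_prop)]
    finiteness
  refine iInf₂_le_of_le Q (isOptimalMap_of_monotoneOn hQ hmono hQfin) ?_
  refine iInf₂_le_of_le (step a) ?_ le_rfl
  rw [← map_step]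
  exact isOptimalMap_of_monotoneOn (measurable_step a) ((monotone_step a).monotoneOn _) hstep

/-! ### Quantile functions -/

/-- The quantile function of `μ` on `(0,1)`, extended by `0`. -/
noncomputable def quantile (μ : Measure ℝ) (x : ℝ) : ℝ :=
  (Ioo (0 : ℝ) 1).indicator (fun x => sInf {t | x ≤ cdf μ t}) x

/-- Right-continuity of the distribution function makes the infimum attained. -/
theorem quantile_le_iff (μ : Measure ℝ) {x : ℝ} (hx : x ∈ Ioo (0 : ℝ) 1) (t : ℝ) :
    quantile μ x ≤ t ↔ x ≤ cdf μ t := by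
  have hne : {t | x ≤ cdf μ t}.Nonempty :=
    ((tendsto_cdf_atTop μ).eventually (eventually_ge_nhds hx.2)).exists
  obtain ⟨b, hb⟩ := ((tendsto_cdf_atBot μ).eventually (eventually_lt_nhds hx.1)).exists
  have hbdd : BddBelow {t | x ≤ cdf μ t} :=
    ⟨b, fun t ht => le_of_not_gt fun h => absurd ((ht.trans (monotone_cdf μ h.le))) (not_le.2 hb)⟩
  rw [quantile, indicator_of_mem hx]
  refine ⟨fun h => ?_, fun h => csInf_le hbdd h⟩
  have hlim := ((cdf μ).right_continuous t).mono Ioi_subset_Ici_self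
  refine ge_of_tendsto hlim ?_
  filter_upwards [self_mem_nhdsWithin] with s hs
  obtain ⟨r, hr, hrs⟩ := exists_lt_of_csInf_lt hne (h.trans_lt hs)
  exact hr.trans (monotone_cdf μ hrs.le)

theorem monotoneOn_quantile (μ : Measure ℝ) : MonotoneOn (quantile μ) (Ioo 0 1) :=
  fun _ hx _ hy h => (quantile_le_iff μ hx _).2 (h.trans ((quantile_le_iff μ hy _).1 le_rfl))

theorem measurable_quantile (μ : Measure ℝ) : Measurable (quantile μ) := by
  refine measurable_of_Iic fun t => ?_
  have h : quantile μ ⁻¹' Iic t =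
      (Ioo 0 1 ∩ Iic (cdf μ t)) ∪ ((Ioo 0 1)ᶜ ∩ {_x | (0 : ℝ) ≤ t}) := by
    ext x
    by_cases hx : x ∈ Ioo (0 : ℝ) 1
    · simp [quantile_le_iff μ hx, hx, -mem_Ioo]
    · simp [quantile, hx, -mem_Ioo]
  rw [h]
  exact (measurableSet_Ioo.inter measurableSet_Iic).union
    (measurableSet_Ioo.compl.inter (MeasurableSet.const _))

theorem map_quantile (μ : Measure ℝ) [IsProbabilityMeasure μ] :
    (uniformUnit : Measure ℝ).map (quantile μ) = μ := by
  have := Measure.isProbabilityMeasure_map (μ := (uniformUnit : Measure ℝ))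
    (measurable_quantile μ).aemeasurable
  refine Measure.ext_of_Iic _ _ fun t => ?_
  rw [Measure.map_apply (measurable_quantile μ) measurableSet_Iic, ← ofReal_cdf μ t]
  have h : quantile μ ⁻¹' Iic t =ᵐ[(uniformUnit : Measure ℝ)] Iic (cdf μ t) := by
    filter_upwards [ae_uniformUnit_mem_Ioo] with x hx
    exact propext (quantile_le_iff μ hx t)
  rw [measure_congr h, coe_uniformUnit, Measure.restrict_apply measurableSet_Iic]
  have : Iic (cdf μ t) ∩ Icc 0 1 = Icc 0 (cdf μ t) := by
    ext x
    simp only [mem_inter_iff, mem_Iic, mem_Icc]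
    exact ⟨fun h => ⟨h.2.1, h.1⟩, fun h => ⟨h.2, h.1, h.2.trans (cdf_le_one μ t)⟩⟩
  rw [this, Real.volume_Icc, sub_zero]

theorem quantile_mem_Icc {μ : ProbabilityMeasure ℝ} (hμ : μ ∈ probOn (Icc (0 : ℝ) 1)) {x : ℝ}
    (hx : x ∈ Ioo (0 : ℝ) 1) : quantile μ x ∈ Icc (0 : ℝ) 1 := by
  have hμ' : (μ : Measure ℝ) (Icc 0 1)ᶜ = 0 := (prob_compl_eq_zero_iff measurableSet_Icc).2 hμ
  constructor
  · by_contra! h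
    have h1 : x ≤ cdf μ (quantile μ x) := (quantile_le_iff μ hx _).1 le_rfl
    have h2 : (μ : Measure ℝ) (Iic (quantile μ x)) = 0 :=
      measure_mono_null (t := (Icc (0 : ℝ) 1)ᶜ)
        (fun t ht h' => absurd (lt_of_le_of_lt ht h) (not_lt.2 h'.1)) hμ'
    rw [cdf_eq_real, measureReal_def, h2] at h1
    exact absurd hx.1 (not_lt.2 h1)
  · rw [quantile_le_iff μ hx, cdf_eq_real, measureReal_def]
    have h2 : (μ : Measure ℝ) (Iic 1) = 1 :=
      le_antisymm prob_le_one (hμ.symm.le.trans (measure_mono Icc_subset_Iic_self))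
    simpa [h2] using hx.2.le

/-- Every quantile function of a measure on `[0,1]` is a `leftMass`: take for `l` the law of
the distribution function under the uniform measure. -/
theorem exists_leftMass_eq_quantile {μ : ProbabilityMeasure ℝ}
    (hμ : μ ∈ probOn (Icc (0 : ℝ) 1)) :
    ∃ l : ProbabilityMeasure (Icc (0 : ℝ) 1),
      ∀ x ∈ Ioo (0 : ℝ) 1, leftMass l x = quantile μ x := by
  let f : ℝ → Icc (0 : ℝ) 1 := fun t => ⟨cdf μ t, cdf_nonneg _ t, cdf_le_one _ t⟩
  have hf : Measurable f := (monotone_cdf (μ : Measure ℝ)).measurable.subtype_mk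
  refine ⟨uniformUnit.map hf.aemeasurable, fun x hx => ?_⟩
  obtain ⟨hq0, hq1⟩ := quantile_mem_Icc hμ hx
  have hs : MeasurableSet {a : Icc (0 : ℝ) 1 | (a : ℝ) < x} :=
    measurableSet_lt measurable_subtype_coe measurable_const
  rw [leftMass, ProbabilityMeasure.toMeasure_map, map_measureReal_apply hf hs, coe_uniformUnit,
    measureReal_restrict_apply (hf hs)]
  -- By the Galois connection F(t) < x means t < Q(x), and Q(x) ≤ 1, so the set is an interval of
  -- length Q(x).
  have : f ⁻¹' {a | (a : ℝ) < x} ∩ Icc 0 1 = Ico 0 (quantile μ x) := by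
    ext t
    have ht : cdf μ t < x ↔ t < quantile μ x := by
      rw [← not_le, ← not_le, quantile_le_iff μ hx]
    simp only [f, mem_inter_iff, mem_preimage, mem_ofPred_eq, mem_Icc, mem_Ico, ht]
    exact ⟨fun h => ⟨h.2.1, h.1⟩, fun h => ⟨h.2, h.1, h.2.le.trans hq1⟩⟩
  rw [this]
  simp [measureReal_def, hq0]

/-! ### The minimizers -/

/-- The law of `leftMass l` under the uniform measure. -/
noncomputable def barycenter (l : ProbabilityMeasure (Icc (0 : ℝ) 1)) : ProbabilityMeasure ℝ :=
  uniformUnit.map (monotone_leftMass l).measurable.aemeasurable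

theorem barycenter_mem_probOn (l : ProbabilityMeasure (Icc (0 : ℝ) 1)) :
    barycenter l ∈ probOn (Icc (0 : ℝ) 1) := by
  change ((uniformUnit : Measure ℝ).map (leftMass l)) (Icc 0 1) = 1
  rw [Measure.map_apply (monotone_leftMass l).measurable measurableSet_Icc,
    preimage_eq_univ_iff.2 (range_subset_iff.2 (leftMass_mem l)), measure_univ]

/-- A functional with the value `∫∫ |Q - T_a|² dl(a)` at the law of every monotone `Q`, where `T_a`
is the optimal map to the `a`-th two-point measure, has a unique minimizer. -/
theorem mem_argmin_iff_eq_barycenter (l : ProbabilityMeasure (Icc (0 : ℝ) 1))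
    {D : Measure ℝ → Measure ℝ → ℝ≥0∞}
    (hD : ∀ Q : ℝ → ℝ, Measurable Q → MonotoneOn Q (Ioo 0 1) → ∀ a : Icc (0 : ℝ) 1,
      D ((uniformUnit : Measure ℝ).map Q) (twoPoint a : Measure ℝ) =
        ∫⁻ x, ‖Q x - step a x‖ₑ ^ 2 ∂(uniformUnit : Measure ℝ)) (ν : ProbabilityMeasure ℝ) :
    (ν ∈ argmin fun ν => ∫⁻ a, D (ν : Measure ℝ) (twoPoint a : Measure ℝ)
      ∂(l : Measure (Icc (0 : ℝ) 1))) ↔ ν = barycenter l := by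
  have hval (Q : ℝ → ℝ) (hQ : Measurable Q) (hm : MonotoneOn Q (Ioo 0 1)) :
      ∫⁻ a, D ((uniformUnit : Measure ℝ).map Q) (twoPoint a : Measure ℝ)
          ∂(l : Measure (Icc (0 : ℝ) 1)) =
        ∫⁻ x, ‖Q x - leftMass l x‖ₑ ^ 2 ∂(uniformUnit : Measure ℝ) +
          ∫⁻ x, ENNReal.ofReal (leftMass l x - leftMass l x ^ 2) ∂(uniformUnit : Measure ℝ) := by
    simp only [hD Q hQ hm]
    exact lintegral_lintegral_step l hQ
  have hL := (monotone_leftMass l).measurable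
  have hC := lintegral_leftMass_sub_sq_ne_top l
  -- Every competitor is the law of its quantile function, so the formula for monotone Q covers all
  -- of them.
  have hν (ν : ProbabilityMeasure ℝ) := hval _ (measurable_quantile ν) (monotoneOn_quantile ν)
  simp only [map_quantile] at hν
  have hb : ∫⁻ a, D (barycenter l : Measure ℝ) (twoPoint a : Measure ℝ)
      ∂(l : Measure (Icc (0 : ℝ) 1)) =
        ∫⁻ x, ENNReal.ofReal (leftMass l x - leftMass l x ^ 2) ∂(uniformUnit : Measure ℝ) := by
    refine (hval _ hL ((monotone_leftMass l).monotoneOn _)).trans ?_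
    simp
  constructor
  · rintro ⟨-, hmin⟩
    have h := hmin (barycenter l)
    beta_reduce at h
    rw [hb, hν] at h
    have h0 : ∫⁻ x, ‖quantile ν x - leftMass l x‖ₑ ^ 2 ∂(uniformUnit : Measure ℝ) = 0 := by
      rw [← nonpos_iff_eq_zero, ← ENNReal.add_le_add_iff_right hC, zero_add]
      exact h
    have hq := measurable_quantile (ν : Measure ℝ)
    rw [lintegral_eq_zero_iff (by fun_prop)] at h0
    refine Subtype.ext ?_
    change (ν : Measure ℝ) = (uniformUnit : Measure ℝ).map (leftMass l)
    rw [← map_quantile (ν : Measure ℝ)]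
    refine Measure.map_congr ?_
    filter_upwards [h0] with x hx
    simpa [sub_eq_zero] using hx
  · rintro rfl
    refine ⟨hb.trans_ne hC, fun ν => ?_⟩
    simp only [hb, hν ν]
    exact le_add_self

theorem range_barycenter : range barycenter = probOn (Icc (0 : ℝ) 1) := by
  refine Subset.antisymm (range_subset_iff.2 barycenter_mem_probOn) fun μ hμ => ?_
  obtain ⟨l, hl⟩ := exists_leftMass_eq_quantile hμ
  refine ⟨l, Subtype.ext ?_⟩
  change (uniformUnit : Measure ℝ).map (leftMass l) = μ
  rw [← map_quantile (μ : Measure ℝ)]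
  refine Measure.map_congr ?_
  filter_upwards [ae_uniformUnit_mem_Ioo] with x hx
  exact hl x hx

theorem w2BCM_twoPoint : w2BCM twoPoint = probOn (Icc (0 : ℝ) 1) := by
  rw [← range_barycenter]
  ext ν
  refine exists_congr fun l => (mem_argmin_iff_eq_barycenter l (D := wassersteinSq)
    (fun Q hQ hm a => wassersteinSq_map_twoPoint hQ hm a) ν).trans eq_comm

theorem lbcm_twoPoint : lbcm uniformUnit twoPoint = probOn (Icc (0 : ℝ) 1) := by
  rw [← range_barycenter]
  ext ν
  refine exists_congr fun l => (mem_argmin_iff_eq_barycenter l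
    (D := lotSq (uniformUnit : Measure ℝ))
    (fun Q hQ hm a => lotSq_map_twoPoint hQ hm a) ν).trans eq_comm

/-! ### The convex hull -/

theorem convHull_subset_probOn {E : Type*} [MeasurableSpace E] {Ω : Set E}
    {S : Set (ProbabilityMeasure E)} (hS : S ⊆ probOn Ω) : convHull S ⊆ probOn Ω := by
  have hconv : Convex ℝ≥0 {m : Measure E | m Ω = 1} := by
    intro m hm m' hm' s t _ _ hst
    simp only [mem_ofPred_eq] at hm hm' ⊢
    rw [Measure.add_apply, Measure.smul_apply, Measure.smul_apply, hm, hm', ENNReal.smul_def,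
      ENNReal.smul_def, smul_eq_mul, smul_eq_mul, mul_one, mul_one, ← ENNReal.coe_add, hst,
      ENNReal.coe_one]
  exact fun μ hμ => convexHull_min (image_subset_iff.2 hS) hconv hμ

theorem uniformUnit_mem_probOn : uniformUnit ∈ probOn (Icc (0 : ℝ) 1) := by
  simp [probOn, coe_uniformUnit]

theorem twoPoint_mem_probOn (a : Icc (0 : ℝ) 1) : twoPoint a ∈ probOn (Icc (0 : ℝ) 1) := by
  have h0 : (0 : ℝ) ≤ a := a.2.1
  have h1 : (0 : ℝ) ≤ 1 - a := sub_nonneg.2 a.2.2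
  simp [probOn, coe_twoPoint, ← ENNReal.ofReal_add h0 h1]

/-- A lower bound on the integral of a bounded continuous function passes from a set of
probability measures to the closure of its convex hull. -/
theorem le_lintegral_of_mem_closure_convHull {E : Type*} [TopologicalSpace E] [MeasurableSpace E]
    [OpensMeasurableSpace E] {S : Set (ProbabilityMeasure E)}
    (g : BoundedContinuousFunction E ℝ≥0) (c : ℝ≥0∞)
    (hS : ∀ μ ∈ S, c ≤ ∫⁻ x, g x ∂(μ : Measure E)) {μ : ProbabilityMeasure E}
    (hμ : μ ∈ closure (convHull S)) : c ≤ ∫⁻ x, g x ∂(μ : Measure E) := by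
  have hconv : Convex ℝ≥0 {m : Measure E | c ≤ ∫⁻ x, g x ∂m} := by
    intro m hm m' hm' s t _ _ hst
    simp only [mem_ofPred_eq] at hm hm' ⊢
    rw [lintegral_add_measure, lintegral_smul_measure, lintegral_smul_measure]
    simp only [ENNReal.smul_def, smul_eq_mul]
    calc c = (s : ℝ≥0∞) * c + t * c := by
          rw [← add_mul, ← ENNReal.coe_add, hst, ENNReal.coe_one, one_mul]
      _ ≤ _ := by gcongr
  have hcont : Continuous fun ν : ProbabilityMeasure E => ∫⁻ x, g x ∂(ν : Measure E) :=
    continuous_iff_continuousAt.2 fun ν =>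
      ProbabilityMeasure.tendsto_iff_forall_lintegral_tendsto.1 Filter.tendsto_id g
  refine closure_minimal (t := {ν : ProbabilityMeasure E | c ≤ ∫⁻ x, g x ∂(ν : Measure E)})
    (fun ν hν => ?_) (isClosed_le continuous_const hcont) hμ
  refine convexHull_min ?_ hconv hν
  rintro _ ⟨μ, hμ, rfl⟩
  exact hS μ hμ

theorem dirac_half_notMem_closure_convHull :
    (⟨Measure.dirac (1 / 2), inferInstance⟩ : ProbabilityMeasure ℝ) ∉
      closure (convHull ({uniformUnit} ∪ range twoPoint)) := by
  let g : BoundedContinuousFunction ℝ ℝ≥0 :=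
    BoundedContinuousFunction.mkOfBound
      ⟨fun x => min (Real.toNNReal |x - 1 / 2|) 1, by fun_prop⟩ 1 fun x y => by
        have h (x : ℝ) : ((min (Real.toNNReal |x - 1 / 2|) 1 : ℝ≥0) : ℝ) ∈ Icc (0 : ℝ) 1 :=
          ⟨NNReal.coe_nonneg _, by exact_mod_cast min_le_right _ _⟩
        exact (Real.dist_le_of_mem_Icc (h x) (h y)).trans_eq (sub_zero 1)
  have hg (x : ℝ) : (g x : ℝ≥0∞) = min (ENNReal.ofReal |x - 1 / 2|) 1 := by
    change ((min (Real.toNNReal |x - 1 / 2|) 1 : ℝ≥0) : ℝ≥0∞) = _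
    rw [ENNReal.coe_min]; rfl
  intro hmem
  -- The uniform measure gives 1/16 = 1/4 · 1/4 already from [0, 1/4], where g ≥ 1/4; two-point
  -- measures give 1/2.
  have key := le_lintegral_of_mem_closure_convHull g (ENNReal.ofReal (1 / 16)) ?_ hmem
  · change _ ≤ ∫⁻ x, (g x : ℝ≥0∞) ∂(Measure.dirac (1 / 2)) at key
    rw [lintegral_dirac, hg] at key
    norm_num at key
  rintro μ (rfl | ⟨a, rfl⟩)
  · calc ENNReal.ofReal (1 / 16)
        = ∫⁻ _ in Icc (0 : ℝ) (1 / 4), ENNReal.ofReal (1 / 4) := by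
          rw [setLIntegral_const, Real.volume_Icc, ← ENNReal.ofReal_mul (by norm_num)]
          norm_num
      _ ≤ ∫⁻ x in Icc (0 : ℝ) (1 / 4), g x := by
          refine setLIntegral_mono' measurableSet_Icc fun x hx => ?_
          rw [hg, abs_of_nonpos (by linarith [hx.2])]
          refine le_min (ENNReal.ofReal_le_ofReal (by linarith [hx.2])) ?_
          rw [ENNReal.ofReal_le_one]
          norm_num
      _ ≤ ∫⁻ x in Icc (0 : ℝ) 1, g x :=
          lintegral_mono_set (Icc_subset_Icc_right (by norm_num))
  · have h0 : (0 : ℝ) ≤ a := a.2.1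
    have h1 : (0 : ℝ) ≤ 1 - a := sub_nonneg.2 a.2.2
    have e0 : (g 0 : ℝ≥0∞) = ENNReal.ofReal (1 / 2) := by
      rw [hg, min_eq_left] <;> norm_num [abs_of_pos]
    have e1 : (g 1 : ℝ≥0∞) = ENNReal.ofReal (1 / 2) := by
      rw [hg, min_eq_left] <;> norm_num [abs_of_pos]
    rw [coe_twoPoint, lintegral_add_measure, lintegral_smul_measure, lintegral_smul_measure,
      lintegral_dirac, lintegral_dirac, e0, e1, smul_eq_mul, smul_eq_mul, ← add_mul,
      ← ENNReal.ofReal_add h0 h1, ← ENNReal.ofReal_mul (by linarith)]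
    exact ENNReal.ofReal_le_ofReal (by linarith)

end BarycentricCoding

theorem mainTheorem1 :
    -- the W2 barycentric coding model is a dense subset of the probability measures on [0,1]
    (w2BCM twoPoint ⊆ probOn (Set.Icc (0 : ℝ) 1) ∧
      probOn (Set.Icc (0 : ℝ) 1) ⊆ closure (w2BCM twoPoint)) ∧
    -- so is the linear barycentric coding model
    (lbcm uniformUnit twoPoint ⊆ probOn (Set.Icc (0 : ℝ) 1) ∧
      probOn (Set.Icc (0 : ℝ) 1) ⊆ closure (lbcm uniformUnit twoPoint)) ∧
    -- in fact the latter contains every probability measure on [0,1]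
    probOn (Set.Icc (0 : ℝ) 1) ⊆ lbcm uniformUnit twoPoint ∧
    -- the convex hull is a subset that is not dense
    (convHull ({uniformUnit} ∪ Set.range twoPoint) ⊆ probOn (Set.Icc (0 : ℝ) 1) ∧
      ¬ probOn (Set.Icc (0 : ℝ) 1) ⊆
        closure (convHull ({uniformUnit} ∪ Set.range twoPoint))) := by
  have hnot : ¬ probOn (Set.Icc (0 : ℝ) 1) ⊆
      closure (convHull ({uniformUnit} ∪ Set.range twoPoint)) := fun h =>
    dirac_half_notMem_closure_convHull (h (by
      change Measure.dirac (1 / 2 : ℝ) (Set.Icc 0 1) = 1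
      rw [Measure.dirac_apply' _ measurableSet_Icc, Set.indicator_of_mem (by norm_num), Pi.one_apply]))
  rw [w2BCM_twoPoint, lbcm_twoPoint]
  refine ⟨⟨subset_rfl, subset_closure⟩, ⟨subset_rfl, subset_closure⟩, subset_rfl,
    convHull_subset_probOn ?_, hnot⟩
  rintro μ (rfl | ⟨a, rfl⟩)
  exacts [uniformUnit_mem_probOn, twoPoint_mem_probOn a]
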